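/- Let $k\ge 1$ and $n>2k$ be integers. On Minkowski space $\mathbb{R}^{n+1,1}$, with coordinates $(x,\tau)=(x^0,\dots,x^n,\tau)$ and metric $-d\tau^2+|dx|^2$, let $\widetilde\Delta=\sum_{i=0}^n\partial_{x^i}^2-\partial_\tau^2$, and let $\widetilde{\mathcal E}[w]$ be the space of smooth functions on $\{x\neq 0,\ \tau>0\}$ that are homogeneous of degree $w$ with respect to the dilations $(x,\tau)\mapsto(cx,c\tau)$, $c>0$. Identify the round sphere $S^n=\{|x|=1\}\subset\mathbb{R}^{n+1}$ with the section $\{|x|=\tau=1\}$ of the future null cone. For $m\in\mathbb{N}_0$ and $w_1,w_2\in\mathbb{R}$ put $$\widetilde D_{2m;w_1,w_2}(\widetilde u\otimes\widetilde v)=\sum_{s=0}^{m}\sum_{t=0}^{m-s}\frac{m!}{(m-s-t)!\,s!\,t!}\,a_{s,t}\,\widetilde\Delta^{m-s-t}\bigl((\widetilde\Delta^s\widetilde u)(\widetilde\Delta^t\widetilde v)\bigr),$$ $$a_{s,t}=\frac{\Gamma\bigl(-w_1-w_2-\frac{n-2m}{2}+s+t\bigr)\,\Gamma\bigl(w_1+\frac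 n2-s\bigr)\,\Gamma\bigl(w_2+\frac n2-t\bigr)}{\Gamma\bigl(-w_1-w_2-\frac{n-2m}{2}\bigr)\,\Gamma\bigl(w_1+\frac{n-2m}{2}\bigr)\,\Gamma\bigl(w_2+\frac{n-2m}{2}\bigr)},$$ where the ratio of Gamma functions is understood via analytic continuation. For $(m;w_1,w_2)=\bigl(k;-\tfrac{n-2k}{3},-\tfrac{n-2k}{3}\bigr)$ and for $(m;w_1,w_2)=\bigl(k-1;-\tfrac{n-2k+3}{3},-\tfrac{n-2k}{3}\bigr)$, the restriction of $\widetilde D_{2m;w_1,w_2}(\widetilde u\otimes\widetilde v)$ to $S^n$, for $\widetilde u\in\widetilde{\mathcal E}[w_1]$ and $\widetilde v\in\widetilde{\mathcal E}[w_2]$, depends only on the restrictions $u=\widetilde u|_{S^n}$ and $v=\widetilde v|_{S^n}$. It therefore defines a bidifferential operator $D_{2m;w_1,w_2}(u\otimes v)$ on $C^\infty(S^n)\otimes C^\infty(S^n)$. Write $D_{2k}=D_{2k;-\frac{n-2k}{3},-\frac{n-2k}{3}}$. Then, as operators on $C^\infty(S^n)\otimes C^\infty(S^n)$, $$\sum_{i=0}^n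 x^i\,[D_{2k},x^i]=-\frac{k\,(n-2k)(n+2k-2)(n+k-3)}{18}\;D_{2k-2;-\frac{n-2k+3}{3},-\frac{n-2k}{3}},$$ where $[D,f](u\otimes v)=D\bigl((uf)\otimes v\bigr)-f\,D(u\otimes v)$ and $x^0,\dots,x^n$ are the Cartesian coordinates of $\mathbb{R}^{n+1}$ restricted to $S^n$. -/

import Mathlib

open scoped Manifold ContDiff

noncomputable section

namespace OvsienkoRedou

/-- The unit sphere `S^n` in `ℝ^{n+1}`, with its standard smooth structure. -/
abbrev Sph (n : ℕ) : Type := Metric.sphere (0 : EuclideanSpace ℝ (Fin (n + 1))) 1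

/-- Minkowski space `ℝ^{n+1,1}`; a point is `(x, τ)` with `x = (x^0, …, x^n)`. -/
abbrev Minkowski (n : ℕ) : Type := EuclideanSpace ℝ (Fin (n + 1)) × ℝ

/-- The dilation-invariant open set `{x ≠ 0, τ > 0}`. It contains the future null cone
`{|x| = τ > 0}`, which is the ray bundle of metrics of the conformal class of the round sphere.
Smooth homogeneous functions are considered on this set. -/
def ambientDomain (n : ℕ) : Set (Minkowski n) := {p | p.1 ≠ 0 ∧ 0 < p.2}

/-- The derivative of `f` in the constant direction `v`. -/
def dirDeriv {n : ℕ} (v : Minkowski n) (f : Minkowski n → ℝ) : Minkowski n → ℝ :=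
  fun p => fderiv ℝ f p v

/-- The Laplacian `∑ᵢ ∂²/∂(x^i)² - ∂²/∂τ²` of the Minkowski metric `-dτ² + dx²`. -/
def ambientLaplacian {n : ℕ} (f : Minkowski n → ℝ) : Minkowski n → ℝ := fun p =>
  (∑ i : Fin (n + 1),
    dirDeriv (EuclideanSpace.single i (1 : ℝ), 0)
      (dirDeriv (EuclideanSpace.single i (1 : ℝ), 0) f) p)
  - dirDeriv (0, 1) (dirDeriv (0, 1) f) p

/-- The space of smooth functions on `ambientDomain n`, homogeneous of degree `w` with respect to
dilations. The values of `f` outside the domain are irrelevant. -/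
structure IsHomogeneous {n : ℕ} (w : ℝ) (f : Minkowski n → ℝ) : Prop where
  smooth : ContDiffOn ℝ ∞ f (ambientDomain n)
  homogeneous : ∀ c : ℝ, 0 < c → ∀ p ∈ ambientDomain n, f (c • p) = c ^ w * f p

/-- The rising factorial `(z)_m = z (z + 1) ⋯ (z + m - 1)`, that is, the analytic continuation of
`Γ(z + m) / Γ(z)`. -/
def rising (z : ℝ) (m : ℕ) : ℝ := (ascPochhammer ℝ m).eval z

theorem rising_eq_Gamma (z : ℝ) (m : ℕ) (hz : ∀ j : ℕ, z ≠ -(j : ℝ)) :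
    rising z m = Real.Gamma (z + m) / Real.Gamma z := by
  have h0 : Real.Gamma z ≠ 0 := Real.Gamma_ne_zero hz
  induction m with
  | zero => simp [rising, h0]
  | succ m ih =>
    have h1 : z + m ≠ 0 := fun h => hz m (by linarith)
    have h2 : rising z (m + 1) = rising z m * (z + m) := by
      simp [rising, ascPochhammer_succ_eval]
    rw [h2, ih, Nat.cast_succ, ← add_assoc, Real.Gamma_add_one h1]
    ring

/-- The coefficient `a_{s,t}` of the Ovsienko-Redou operator, for `s, t ≤ k`: the analytic
continuation of the ratio of Gamma functions displayed in `coeff_eq_Gamma`. -/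
def coeff (n k : ℕ) (w₁ w₂ : ℝ) (s t : ℕ) : ℝ :=
  rising (-w₁ - w₂ - ((n : ℝ) - 2 * k) / 2) (s + t)
    * rising (w₁ + ((n : ℝ) - 2 * k) / 2) (k - s)
    * rising (w₂ + ((n : ℝ) - 2 * k) / 2) (k - t)

theorem coeff_eq_Gamma (n k : ℕ) (w₁ w₂ : ℝ) (s t : ℕ) (hs : s ≤ k) (ht : t ≤ k)
    (h₀ : ∀ j : ℕ, -w₁ - w₂ - ((n : ℝ) - 2 * k) / 2 ≠ -(j : ℝ))
    (h₁ : ∀ j : ℕ, w₁ + ((n : ℝ) - 2 * k) / 2 ≠ -(j : ℝ))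
    (h₂ : ∀ j : ℕ, w₂ + ((n : ℝ) - 2 * k) / 2 ≠ -(j : ℝ)) :
    coeff n k w₁ w₂ s t =
      (Real.Gamma (-w₁ - w₂ - ((n : ℝ) - 2 * k) / 2 + s + t)
          * Real.Gamma (w₁ + (n : ℝ) / 2 - s) * Real.Gamma (w₂ + (n : ℝ) / 2 - t))
        / (Real.Gamma (-w₁ - w₂ - ((n : ℝ) - 2 * k) / 2)
          * Real.Gamma (w₁ + ((n : ℝ) - 2 * k) / 2)
          * Real.Gamma (w₂ + ((n : ℝ) - 2 * k) / 2)) := by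
  have e₁ : w₁ + ((n : ℝ) - 2 * k) / 2 + ((k - s : ℕ) : ℝ) = w₁ + (n : ℝ) / 2 - s := by
    rw [Nat.cast_sub hs]; ring
  have e₂ : w₂ + ((n : ℝ) - 2 * k) / 2 + ((k - t : ℕ) : ℝ) = w₂ + (n : ℝ) / 2 - t := by
    rw [Nat.cast_sub ht]; ring
  have e₀ : -w₁ - w₂ - ((n : ℝ) - 2 * k) / 2 + ((s + t : ℕ) : ℝ)
      = -w₁ - w₂ - ((n : ℝ) - 2 * k) / 2 + s + t := by
    push_cast; ring
  rw [coeff, rising_eq_Gamma _ _ h₀, rising_eq_Gamma _ _ h₁, rising_eq_Gamma _ _ h₂, e₀, e₁, e₂]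
  ring

/-- The multinomial coefficient `k! / ((k - s - t)! s! t!)`, for `s + t ≤ k`. -/
def multinom (k s t : ℕ) : ℝ :=
  (k.factorial : ℝ) / ((k - s - t).factorial * s.factorial * t.factorial)

/-- The ambient bidifferential operator
`∑_{s+t≤k} (k!/((k-s-t)! s! t!)) a_{s,t} Δ^{k-s-t} ((Δ^s f) (Δ^t g))`. -/
def ambientOperator (n k : ℕ) (w₁ w₂ : ℝ) (f g : Minkowski n → ℝ) : Minkowski n → ℝ := fun p =>
  ∑ s ∈ Finset.range (k + 1), ∑ t ∈ Finset.range (k - s + 1),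
    multinom k s t * coeff n k w₁ w₂ s t
      * ambientLaplacian^[k - s - t]
          (fun q => ambientLaplacian^[s] f q * ambientLaplacian^[t] g q) p

/-- Restriction to the section `τ = 1` of the null cone, which is the round sphere `(S^n, dθ²)`. -/
def restrict {n : ℕ} (f : Minkowski n → ℝ) : Sph n → ℝ := fun x => f (x.1, 1)

/-- The extension `(x, τ) ↦ |x|^w u(x/|x|)` of `u`, homogeneous of degree `w`. -/
def extend {n : ℕ} (w : ℝ) (u : Sph n → ℝ) : Minkowski n → ℝ := fun p =>
  if h : p.1 = 0 then 0
  else ‖p.1‖ ^ w * u ⟨‖p.1‖⁻¹ • p.1, by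
    rw [mem_sphere_zero_iff_norm, norm_smul, norm_inv, norm_norm,
      inv_mul_cancel₀ (norm_ne_zero_iff.mpr h)]⟩

theorem restrict_extend {n : ℕ} (w : ℝ) (u : Sph n → ℝ) : restrict (extend w u) = u := by
  funext x
  have hx : ‖x.1‖ = 1 := mem_sphere_zero_iff_norm.mp x.2
  have h0 : x.1 ≠ 0 := fun h => by rw [h, norm_zero] at hx; exact zero_ne_one hx
  simp [restrict, extend, h0]

/-- So every smooth function on the sphere has a smooth homogeneous extension of each degree. -/
theorem isHomogeneous_extend {n : ℕ} (w : ℝ) (u : Sph n → ℝ)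
    (hu : ContMDiff (𝓡 n) 𝓘(ℝ, ℝ) ∞ u) : IsHomogeneous w (extend w u) := by
  classical
  let E := EuclideanSpace ℝ (Fin (n + 1))
  let U : TopologicalSpace.Opens E := ⟨{x | x ≠ 0}, isOpen_ne⟩
  have hmem : ∀ x : U, ‖(x : E)‖⁻¹ • (x : E) ∈ Metric.sphere (0 : E) 1 := fun x => by
    rw [mem_sphere_zero_iff_norm, norm_smul, norm_inv, norm_norm,
      inv_mul_cancel₀ (norm_ne_zero_iff.mpr x.2)]
  have hnorm : ∀ x : E, x ≠ 0 → ContDiffAt ℝ ∞ (fun y : E => ‖y‖) x := fun x hx =>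
    contDiffAt_norm ℝ hx
  have h1 : ContMDiff 𝓘(ℝ, E) 𝓘(ℝ, E) ∞ (fun x : U => ‖(x : E)‖⁻¹ • (x : E)) := by
    intro x
    refine (contMDiffAt_subtype_iff (U := U) (f := fun y : E => ‖y‖⁻¹ • y)).2 ?_
    exact (((hnorm x x.2).inv (norm_ne_zero_iff.mpr x.2)).smul contDiffAt_id).contMDiffAt
  have := Fact.mk (@finrank_euclideanSpace_fin ℝ _ (n + 1))
  have h2 := hu.comp (h1.codRestrict_sphere hmem)
  let F : E → ℝ := fun y => if h : y = 0 then 0 else u ⟨‖y‖⁻¹ • y, hmem ⟨y, h⟩⟩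
  have h3 : ∀ x : E, x ≠ 0 → ContDiffAt ℝ ∞ F x := by
    intro x hx
    have h4 := (h2 ⟨x, hx⟩)
    have h5 : (u ∘ Set.codRestrict (fun x : U => ‖(x : E)‖⁻¹ • (x : E)) _ hmem)
        = fun x : U => F x := by
      funext y
      have : (y : E) ≠ 0 := y.2
      simp only [F, this, dite_false, Function.comp]
      rfl
    rw [h5] at h4
    exact (contMDiffAt_subtype_iff (U := U) (f := F) (x := ⟨x, hx⟩)).1 h4 |>.contDiffAt
  constructor
  · intro p hp
    have h6 : extend w u = fun q : Minkowski n => ‖q.1‖ ^ w * F q.1 := by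
      funext q
      by_cases h : q.1 = 0
      · simp [extend, F, h]
      · simp [extend, F, h]
    rw [h6]
    refine ContDiffAt.contDiffWithinAt ?_
    have h7 : ContDiffAt ℝ ∞ (fun y : E => ‖y‖ ^ w * F y) p.1 :=
      ((hnorm p.1 hp.1).rpow_const_of_ne (norm_ne_zero_iff.mpr hp.1)).mul (h3 _ hp.1)
    exact h7.comp p contDiffAt_fst
  · intro c hc p hp
    have hp1 : p.1 ≠ 0 := hp.1
    have hcp : c • p.1 ≠ 0 := smul_ne_zero hc.ne' hp1
    have h8 : ‖c • p.1‖⁻¹ • c • p.1 = ‖p.1‖⁻¹ • p.1 := by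
      rw [norm_smul, Real.norm_of_nonneg hc.le, smul_smul, mul_inv, mul_right_comm,
        inv_mul_cancel₀ hc.ne', one_mul]
    simp only [extend, Prod.smul_fst, hcp, hp1, dite_false, h8]
    rw [norm_smul, Real.norm_of_nonneg hc.le, Real.mul_rpow hc.le (norm_nonneg _), mul_assoc]

/-- The ambient operator `T`, acting on homogeneous functions of degrees `w₁` and `w₂`, is
tangential and induces the operator `D` on the round sphere: whatever homogeneous functions `f`
and `g` are chosen, `T(f ⊗ g)` restricts to `D` of the restrictions of `f` and `g`. -/
def Induces {n : ℕ} (T : (Minkowski n → ℝ) → (Minkowski n → ℝ) → Minkowski n → ℝ) (w₁ w₂ : ℝ)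
    (D : (Sph n → ℝ) → (Sph n → ℝ) → Sph n → ℝ) : Prop :=
  ∀ f g : Minkowski n → ℝ, IsHomogeneous w₁ f → IsHomogeneous w₂ g →
    restrict (T f g) = D (restrict f) (restrict g)

/-- The Ovsienko-Redou operator `D_{2k;w₁,w₂}` of the round sphere: extend `u` and `v` to
homogeneous functions of degrees `w₁` and `w₂`, apply the ambient operator, and restrict. -/
def sphereOperator (n k : ℕ) (w₁ w₂ : ℝ) (u v : Sph n → ℝ) : Sph n → ℝ :=
  restrict (ambientOperator n k w₁ w₂ (extend w₁ u) (extend w₂ v))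

/-- The coordinate function `x^i` on the sphere. -/
def coord {n : ℕ} (i : Fin (n + 1)) : Sph n → ℝ := fun x => x.1 i

/-- The commutator `[D, f](u ⊗ v) = D((u f) ⊗ v) - f D(u ⊗ v)`. -/
def commutator {n : ℕ} (D : (Sph n → ℝ) → (Sph n → ℝ) → Sph n → ℝ) (f u v : Sph n → ℝ) :
    Sph n → ℝ :=
  fun x => D (u * f) v x - f x * D u v x

end OvsienkoRedou

end

/-! Write Δ for the ambient Laplacian, E for the Euler field, Q = |x|² - τ², and X_I, ε_I for the
Minkowski coordinates and signs. Everything rests on [Δ, X_I] = 2 ε_I ∂_I and [Δ, Q] = 4E + 2(n +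
2), iterated over powers of Δ and evaluated on functions of known degree.

Tangentiality. Two homogeneous extensions of the same u agree on the null cone. By Hadamard's lemma
(`exists_eq_quad_mul`) they differ by Q b, with b of degree w - 2. Commuting Q past all the
Laplacians leaves two families of terms, which cancel after a shift of s by the recursion for
a_{s,t} (`ovsienkoRedou_quad_mul`). Hence Q b contributes a multiple of Q, which vanishes on the
sphere.

Commutator formula. As ∑ (x^i)² = 1, the left side is ∑ x^i D(x^i u ⊗ v) - D(u ⊗ v). Extend u to U
of degree w - 1. Then x^i U and τ U have degree w and extend x^i u and u, so tangentiality turns the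
left side into the restriction of the Lorentzian contraction ∑ ε_I X_I D(X_I U ⊗ V). Commuting X_I
outwards produces a multiple of Q and terms with one Laplacian fewer; the remaining gradient
products are expressed through Laplacians by polarization (`sum_x_mul_lap_pow`). Collecting
coefficients leaves a polynomial identity (`coeff_commutator`), whose constant depends on s, t only
through k.

The computations take place in an abstract commutative algebra with commuting derivations, then are
applied to the smooth functions on the ambient domain. -/

noncomputable section

namespace OvsienkoRedou

/-! ### Sums over triangles -/

section TriangleSum

variable {M : Type*} [AddCommMonoid M]

/-- The sum of `F s t` over `s + t ≤ m`. -/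
def triSum (m : ℕ) (F : ℕ → ℕ → M) : M :=
  ∑ s ∈ Finset.range (m + 1), ∑ t ∈ Finset.range (m - s + 1), F s t

theorem triSum_congr {m : ℕ} {F G : ℕ → ℕ → M} (h : ∀ s t, s + t ≤ m → F s t = G s t) :
    triSum m F = triSum m G := by
  refine Finset.sum_congr rfl fun s hs => Finset.sum_congr rfl fun t ht => h s t ?_
  rw [Finset.mem_range] at hs ht
  omega

theorem triSum_add (m : ℕ) (F G : ℕ → ℕ → M) :
    triSum m (fun s t => F s t + G s t) = triSum m F + triSum m G := by
  simp only [triSum, Finset.sum_add_distrib]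

theorem triSum_swap (m : ℕ) (F : ℕ → ℕ → M) :
    triSum m F = triSum m (fun s t => F t s) := by
  refine Finset.sum_comm' fun s t => ?_
  simp only [Finset.mem_range]
  omega

theorem triSum_succ_of_diag_eq_zero {m : ℕ} {F : ℕ → ℕ → M}
    (h : ∀ s t, s + t = m + 1 → F s t = 0) : triSum (m + 1) F = triSum m F := by
  rw [triSum, Finset.sum_range_succ, Finset.sum_eq_zero (s := Finset.range (m + 1 - (m + 1) + 1)),
    add_zero]
  · refine Finset.sum_congr rfl fun s hs => ?_
    rw [Finset.mem_range] at hs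
    rw [show m + 1 - s + 1 = (m - s + 1) + 1 by omega, Finset.sum_range_succ,
      h s (m - s + 1) (by omega), add_zero]
  · intro t ht
    rw [Finset.mem_range] at ht
    exact h _ _ (by omega)

theorem triSum_succ_of_left_eq_zero {m : ℕ} {F : ℕ → ℕ → M} (h : ∀ t, F 0 t = 0) :
    triSum (m + 1) F = triSum m (fun s t => F (s + 1) t) := by
  rw [triSum, Finset.sum_range_succ']
  simp [h, triSum]

theorem triSum_succ_of_right_eq_zero {m : ℕ} {F : ℕ → ℕ → M} (h : ∀ s, F s 0 = 0) :
    triSum (m + 1) F = triSum m (fun s t => F s (t + 1)) := by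
  rw [triSum_swap, triSum_succ_of_left_eq_zero h, triSum_swap]

/-- Reindexing for terms in which one Laplacian moves from the first factor to the second: (s + 1,
t) becomes (s, t + 1). The vanishing hypotheses discard the boundary terms without a partner. -/
theorem triSum_succ_shift {m : ℕ} {F G : ℕ → ℕ → M} (h₀ : ∀ t, F 0 t = 0)
    (h₁ : ∀ s t, s + t = m + 1 → F s t = 0) (hG₀ : ∀ s, G s 0 = 0)
    (hG : ∀ s t, s + t + 1 ≤ m → G s (t + 1) = F (s + 1) t) : triSum (m + 1) F = triSum m G := by
  rw [triSum_succ_of_left_eq_zero h₀]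
  cases m with
  | zero => simp [triSum, hG₀, h₁]
  | succ m =>
    rw [triSum_succ_of_diag_eq_zero fun s t h => h₁ _ _ (by omega),
      triSum_succ_of_right_eq_zero hG₀]
    exact triSum_congr fun s t h => (hG s t (by omega)).symm

theorem map_triSum {M' H : Type*} [AddCommMonoid M'] [FunLike H M M'] [AddMonoidHomClass H M M']
    (φ : H) (m : ℕ) (F : ℕ → ℕ → M) : φ (triSum m F) = triSum m (fun s t => φ (F s t)) := by
  simp only [triSum, map_sum]

end TriangleSum

/-! ### Flat coordinates in a commutative algebra -/

/-- Commuting derivations `∂ᵢ` of a commutative algebra, coordinates `xᵢ` dual to them, and the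
signs `εᵢ` of a flat metric. -/
structure FlatCoordinates (A ι : Type*) [CommRing A] [Algebra ℝ A] [DecidableEq ι] where
  d : ι → Derivation ℝ A A
  x : ι → A
  ε : ι → ℝ
  d_comm : ∀ i j f, d i (d j f) = d j (d i f)
  d_x : ∀ i j, d i (x j) = if i = j then 1 else 0
  ε_mul_ε : ∀ i, ε i * ε i = 1

namespace FlatCoordinates

variable {A ι : Type*} [CommRing A] [Algebra ℝ A] [DecidableEq ι] (C : FlatCoordinates A ι)

theorem d_mul (i : ι) (f g : A) : C.d i (f * g) = C.d i f * g + f * C.d i g := by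
  rw [Derivation.leibniz, smul_eq_mul, smul_eq_mul]
  ring

variable [Fintype ι]

/-- The Laplacian `∑ εᵢ ∂ᵢ²`. -/
def lap : Module.End ℝ A := ∑ i, C.ε i • ((C.d i : A →ₗ[ℝ] A) ∘ₗ (C.d i : A →ₗ[ℝ] A))

/-- The Euler field `∑ xᵢ ∂ᵢ`. -/
def euler : Derivation ℝ A A := ∑ i, C.x i • C.d i

/-- The quadratic form `∑ εᵢ xᵢ²`. -/
def quad : A := ∑ i, C.ε i • (C.x i * C.x i)

theorem lap_apply (f : A) : C.lap f = ∑ i, C.ε i • C.d i (C.d i f) := by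
  simp [lap]

theorem euler_apply (f : A) : C.euler f = ∑ i, C.x i * C.d i f := by
  simp only [euler, ← Derivation.coeFnAddMonoidHom_apply, map_sum, Finset.sum_apply]
  rfl

theorem lap_mul (f g : A) :
    C.lap (f * g) = C.lap f * g + f * C.lap g + 2 * ∑ i, C.ε i • (C.d i f * C.d i g) := by
  simp only [lap_apply, d_mul, map_add, Finset.sum_mul, Finset.mul_sum, ← Finset.sum_add_distrib]
  refine Finset.sum_congr rfl fun i _ => ?_
  simp only [Algebra.smul_def]
  ring

theorem d_lap (i : ι) (f : A) : C.d i (C.lap f) = C.lap (C.d i f) := by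
  simp only [lap_apply, map_sum, Derivation.map_smul]
  refine Finset.sum_congr rfl fun j _ => ?_
  rw [C.d_comm i j, C.d_comm i j]

theorem lap_x_mul (i : ι) (f : A) :
    C.lap (C.x i * f) = C.x i * C.lap f + (2 * C.ε i) • C.d i f := by
  have h₁ : C.lap (C.x i) = 0 := by
    rw [lap_apply]
    refine Finset.sum_eq_zero fun j _ => ?_
    rw [C.d_x]
    split_ifs <;> simp
  rw [lap_mul, h₁, zero_mul, zero_add]
  congr 1
  simp only [C.d_x, ite_mul, one_mul, zero_mul, smul_ite, smul_zero, Finset.sum_ite_eq',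
    Finset.mem_univ, if_true]
  rw [mul_smul, two_smul, two_mul]

theorem lap_pow_succ (r : ℕ) (f : A) : (C.lap ^ (r + 1)) f = C.lap ((C.lap ^ r) f) := by
  rw [pow_succ', Module.End.mul_apply]

theorem d_lap_pow (i : ι) (r : ℕ) (f : A) :
    C.d i ((C.lap ^ r) f) = (C.lap ^ r) (C.d i f) := by
  induction r with
  | zero => simp
  | succ r ih => rw [lap_pow_succ, d_lap, ih, lap_pow_succ]

/-- Each of the r factors Δ contributes one 2 ε_i ∂_i, which commutes with the others. At r = 0 the
truncated exponent `r - 1` is harmless, since its coefficient is zero. -/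
theorem lap_pow_x_mul (i : ι) (r : ℕ) (f : A) :
    (C.lap ^ r) (C.x i * f) =
      C.x i * (C.lap ^ r) f + (2 * r * C.ε i) • C.d i ((C.lap ^ (r - 1)) f) := by
  induction r with
  | zero => simp
  | succ r ih =>
    rw [lap_pow_succ, ih, map_add, lap_x_mul, map_smul, ← d_lap, ← lap_pow_succ, add_assoc]
    congr 1
    rw [← lap_pow_succ]
    cases r with
    | zero => simp
    | succ r =>
      simp only [Nat.add_sub_cancel, ← add_smul]
      congr 1
      push_cast
      ring

theorem euler_lap (f : A) : C.euler (C.lap f) = C.lap (C.euler f) - (2 : ℝ) • C.lap f := by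
  rw [euler_apply, euler_apply, map_sum]
  simp only [lap_x_mul, Finset.sum_add_distrib, d_lap]
  have : ∑ i, (2 * C.ε i) • C.d i (C.d i f) = (2 : ℝ) • C.lap f := by
    simp only [lap_apply, Finset.smul_sum, mul_smul]
  rw [this, add_sub_cancel_right]

theorem euler_lap_pow {f : A} {w : ℝ} (h : C.euler f = w • f) (r : ℕ) :
    C.euler ((C.lap ^ r) f) = (w - 2 * r) • (C.lap ^ r) f := by
  induction r with
  | zero => simp [h]
  | succ r ih =>
    rw [lap_pow_succ, euler_lap, ih, map_smul, ← sub_smul]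
    congr 1
    push_cast
    ring

theorem euler_mul {f g : A} {w w' : ℝ} (hf : C.euler f = w • f) (hg : C.euler g = w' • g) :
    C.euler (f * g) = (w + w') • (f * g) := by
  rw [Derivation.leibniz, hf, hg, smul_eq_mul, smul_eq_mul]
  simp only [Algebra.smul_def, map_add]
  ring

theorem euler_x (i : ι) : C.euler (C.x i) = (1 : ℝ) • C.x i := by
  simp [euler_apply, C.d_x]

theorem euler_quad : C.euler C.quad = (2 : ℝ) • C.quad := by
  simp only [quad, map_sum, Derivation.map_smul, C.euler_mul (C.euler_x _) (C.euler_x _),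
    Finset.smul_sum]
  refine Finset.sum_congr rfl fun i _ => ?_
  rw [smul_comm]
  norm_num

theorem lap_quad_mul (f : A) :
    C.lap (C.quad * f) =
      C.quad * C.lap f + (4 : ℝ) • C.euler f + (2 * Fintype.card ι : ℝ) • f := by
  have h : ∀ i, C.ε i • C.lap (C.x i * C.x i * f) =
      C.ε i • (C.x i * C.x i) * C.lap f + (4 : ℝ) • (C.x i * C.d i f) + (2 : ℝ) • f := by
    intro i
    have hε : algebraMap ℝ A (C.ε i) * algebraMap ℝ A (C.ε i) = 1 := by
      rw [← map_mul, C.ε_mul_ε, map_one]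
    rw [mul_assoc, lap_x_mul, lap_x_mul, d_mul, C.d_x, if_pos rfl]
    simp only [Algebra.smul_def, map_mul, map_ofNat]
    linear_combination (2 * f + 4 * C.x i * C.d i f) * hε
  rw [quad, Finset.sum_mul, map_sum]
  simp only [smul_mul_assoc, map_smul]
  simp only [h, Finset.sum_add_distrib, ← Finset.smul_sum, ← euler_apply, smul_mul_assoc]
  simp [Finset.sum_mul, mul_smul, two_smul, ← Nat.cast_smul_eq_nsmul ℝ]

/-- The sl₂ relation between Δ, Q and E: the coefficient is the sum over j < r of 4(w - 2j) + 2 ·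
dim, because Δʲ f has degree w - 2j. -/
theorem lap_pow_quad_mul {f : A} {w : ℝ} (h : C.euler f = w • f) (r : ℕ) :
    (C.lap ^ r) (C.quad * f) = C.quad * (C.lap ^ r) f +
      (2 * r * (2 * w + Fintype.card ι + 2 - 2 * r)) • (C.lap ^ (r - 1)) f := by
  induction r with
  | zero => simp
  | succ r ih =>
    rw [lap_pow_succ, ih, map_add, lap_quad_mul, C.euler_lap_pow h, map_smul, ← lap_pow_succ,
      ← lap_pow_succ, Nat.add_sub_cancel]
    cases r with
    | zero =>
      simp only [Algebra.smul_def, map_mul, map_add, map_sub, map_natCast, map_ofNat, map_zero,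
        map_one, Nat.cast_zero, Nat.cast_succ, zero_add, pow_zero]
      ring
    | succ r =>
      simp only [Nat.add_sub_cancel]
      simp only [Algebra.smul_def, map_mul, map_add, map_sub, map_natCast, map_ofNat,
        map_one, Nat.cast_succ]
      ring

/-- The sum `∑ εᵢ xᵢ Δʳ(Δˢ(xᵢ f) Δᵗ g)` that arises from contracting with the position vector. -/
theorem sum_x_mul_lap_pow {f g : A} {a b : ℝ} (hf : C.euler f = a • f) (hg : C.euler g = b • g)
    (r s t : ℕ) :
    ∑ i, C.ε i • (C.x i * (C.lap ^ r) ((C.lap ^ s) (C.x i * f) * (C.lap ^ t) g)) =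
      C.quad * (C.lap ^ r) ((C.lap ^ s) f * (C.lap ^ t) g)
      + (2 * r * (a + b - 2 * s - 2 * t - 2 * (r - 1) - s)) •
        (C.lap ^ (r - 1)) ((C.lap ^ s) f * (C.lap ^ t) g)
      + (2 * s * (a - 2 * (s - 1) - r)) •
        (C.lap ^ r) ((C.lap ^ (s - 1)) f * (C.lap ^ t) g)
      + (2 * s * r : ℝ) •
        (C.lap ^ (r - 1)) ((C.lap ^ (s - 1)) f * (C.lap ^ (t + 1)) g) := by
  -- The sign ε_i of the contraction cancels the one in the commutator, so the derivatives assemble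
  -- into the Euler field.
  have cont : ∀ F : A, ∑ i, C.ε i • (C.x i * (C.lap ^ r) (C.x i * F)) =
      C.quad * (C.lap ^ r) F + (2 * r : ℝ) • C.euler ((C.lap ^ (r - 1)) F) := by
    intro F
    rw [quad, Finset.sum_mul, euler_apply, Finset.smul_sum, ← Finset.sum_add_distrib]
    refine Finset.sum_congr rfl fun i _ => ?_
    have hε : algebraMap ℝ A (C.ε i) * algebraMap ℝ A (C.ε i) = 1 := by
      rw [← map_mul, C.ε_mul_ε, map_one]
    rw [lap_pow_x_mul]
    simp only [Algebra.smul_def, map_mul, map_ofNat, map_natCast]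
    linear_combination (2 * r * C.x i * C.d i ((C.lap ^ (r - 1)) F)) * hε
  -- Polarization: 2⟨∇G, ∇H⟩ = Δ(GH) - ΔG · H - G · ΔH.
  have div : ∀ G H : A, (2 : ℝ) • ∑ i, C.ε i • C.d i (C.d i G * H) =
      C.lap (G * H) + C.lap G * H - G * C.lap H := by
    intro G H
    simp only [d_mul, smul_add, Finset.sum_add_distrib, lap_mul]
    rw [lap_apply, Finset.sum_mul]
    simp only [smul_mul_assoc, two_smul]
    ring
  -- Moving x_i inside Δʳ gives E G, at the cost of the divergence computed in `div`.
  have grad : ∀ G H : A, ∑ i, C.x i * (C.lap ^ r) (C.d i G * H) =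
      (C.lap ^ r) (C.euler G * H) - (r : ℝ) • ((C.lap ^ (r - 1))
        (C.lap (G * H) + C.lap G * H - G * C.lap H)) := by
    intro G H
    rw [← div, euler_apply, Finset.sum_mul, map_sum, map_smul, map_sum, Finset.smul_sum,
      Finset.smul_sum, ← Finset.sum_sub_distrib]
    refine Finset.sum_congr rfl fun i _ => ?_
    rw [mul_assoc, lap_pow_x_mul, map_smul, d_lap_pow]
    simp only [Algebra.smul_def, map_mul, map_ofNat, map_natCast]
    ring
  have hdeg : C.euler ((C.lap ^ (r - 1)) ((C.lap ^ s) f * (C.lap ^ t) g)) =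
      (a - 2 * s + (b - 2 * t) - 2 * (r - 1 : ℕ)) •
        (C.lap ^ (r - 1)) ((C.lap ^ s) f * (C.lap ^ t) g) :=
    C.euler_lap_pow (C.euler_mul (C.euler_lap_pow hf s) (C.euler_lap_pow hg t)) _
  have split : ∀ i, C.ε i • (C.x i * (C.lap ^ r) ((C.lap ^ s) (C.x i * f) * (C.lap ^ t) g)) =
      C.ε i • (C.x i * (C.lap ^ r) (C.x i * ((C.lap ^ s) f * (C.lap ^ t) g)))
      + (2 * s : ℝ) • (C.x i * (C.lap ^ r) (C.d i ((C.lap ^ (s - 1)) f) * (C.lap ^ t) g)) := by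
    intro i
    have hε : algebraMap ℝ A (C.ε i) * algebraMap ℝ A (C.ε i) = 1 := by
      rw [← map_mul, C.ε_mul_ε, map_one]
    rw [lap_pow_x_mul, add_mul, map_add, smul_mul_assoc, map_smul, mul_assoc]
    simp only [Algebra.smul_def, map_mul, map_ofNat, map_natCast]
    linear_combination (2 * s * C.x i *
      (C.lap ^ r) (C.d i ((C.lap ^ (s - 1)) f) * (C.lap ^ t) g)) * hε
  simp only [split, Finset.sum_add_distrib, ← Finset.smul_sum]
  rw [cont, grad, hdeg, C.euler_lap_pow hf, smul_mul_assoc, map_smul, map_sub, map_add,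
    ← lap_pow_succ, ← lap_pow_succ]
  -- The cases r = 0 and s = 0 are separated because of the truncated exponents `r - 1` and `s - 1`.
  rcases r with _ | r <;> rcases s with _ | s <;>
  · simp only [Nat.add_sub_cancel, ← Module.End.mul_apply, ← pow_succ]
    simp only [Algebra.smul_def, map_mul, map_add, map_sub, map_natCast, map_ofNat, map_zero, map_one,
      Nat.cast_succ, Nat.cast_zero, Nat.zero_sub]
    ring

end FlatCoordinates

/-! ### Coefficients of the Ovsienko-Redou operators -/

theorem rising_succ (z : ℝ) (m : ℕ) : rising z (m + 1) = rising z m * (z + m) := by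
  simp [rising, ascPochhammer_succ_eval]

theorem rising_succ' (z : ℝ) (m : ℕ) : rising z (m + 1) = z * rising (z + 1) m := by
  simp [rising, ascPochhammer_succ_left, Polynomial.eval_comp]

theorem coeff_comm (n k : ℕ) (w₁ w₂ : ℝ) (s t : ℕ) :
    coeff n k w₁ w₂ s t = coeff n k w₂ w₁ t s := by
  rw [coeff, coeff, add_comm s t, show -w₁ - w₂ = -w₂ - w₁ by ring]
  ring

theorem multinom_comm (k s t : ℕ) : multinom k s t = multinom k t s := by
  rw [multinom, multinom, Nat.sub_right_comm, mul_right_comm]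

/-- Parametrizing k = s + t + r removes truncated subtraction; the coefficient identities below all
use this form. -/
theorem multinom_add (s t r : ℕ) :
    multinom (s + t + r) s t = ((s + t + r).factorial : ℝ) /
      (r.factorial * s.factorial * t.factorial) := by
  rw [multinom, show s + t + r - s - t = r by omega]

theorem multinom_succ_mul (s t r : ℕ) :
    multinom (s + t + r + 1) s t * (r + 1) = (s + t + r + 1) * multinom (s + t + r) s t := by
  rw [add_assoc (s + t), multinom_add, multinom_add, ← add_assoc, Nat.factorial_succ,
    Nat.factorial_succ]
  push_cast
  field_simp

theorem multinom_succ_mul_left (s t r : ℕ) :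
    multinom (s + t + r + 1) (s + 1) t * (s + 1) =
      (s + t + r + 1) * multinom (s + t + r) s t := by
  rw [show s + t + r + 1 = s + 1 + t + r by ring, multinom_add, multinom_add,
    show s + 1 + t + r = s + t + r + 1 by ring, Nat.factorial_succ, Nat.factorial_succ]
  push_cast
  field_simp

theorem multinom_succ_mul_right (s t r : ℕ) :
    multinom (s + t + r + 1) s (t + 1) * (t + 1) =
      (s + t + r + 1) * multinom (s + t + r) s t := by
  rw [multinom_comm, add_comm s t, multinom_succ_mul_left, multinom_comm, add_comm (t : ℝ)]

/-- This is Γ(z + 1) = zΓ(z) in the first and second Gamma factors, cross-multiplied so that no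
factor has to be nonzero. -/
theorem coeff_succ_mul (n s t r : ℕ) (w₁ w₂ : ℝ) :
    coeff n (s + t + r + 1) w₁ w₂ (s + 1) t * (w₁ + n / 2 - (s + 1)) =
      coeff n (s + t + r + 1) w₁ w₂ s t *
        (-w₁ - w₂ - n / 2 + (s + t + r + 1) + s + t) := by
  rw [coeff, coeff, show s + t + r + 1 - (s + 1) = t + r by omega,
    show s + t + r + 1 - s = t + r + 1 by omega, show s + 1 + t = s + t + 1 by ring,
    rising_succ, rising_succ]
  push_cast
  ring

/-- The identity between coefficients behind the commutator formula. -/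
theorem coeff_commutator (n s t r : ℕ) {w : ℝ}
    (hw : w = -((n : ℝ) - 2 * (s + t + r + 1)) / 3) :
    (2 * w - 2 * (s + t + r) - 1 - s) * coeff n (s + t + r + 1) w w s t
      + (w - 1 - 2 * s - r) * coeff n (s + t + r + 1) w w (s + 1) t
      + t * coeff n (s + t + r + 1) w w (s + 1) (t - 1) =
    -(((n : ℝ) - 2 * (s + t + r + 1)) * (n + 2 * (s + t + r + 1) - 2) *
      (n + (s + t + r + 1) - 3) / 36) * coeff n (s + t + r) (w - 1) w s t := by
  -- With k = s + t + r + 1, z = (n - 2k)/6. For the weights at level k all three rising factorials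
  -- start at z; at level k - 1 they start at z, z and z + 1. Each coefficient is thus a polynomial
  -- multiple of the one at level k - 1.
  obtain ⟨z, rfl⟩ : ∃ z, w = -2 * z := ⟨-w / 2, by ring⟩
  have hn : (n : ℝ) = 6 * z + 2 * (s + t + r + 1) := by linarith
  have e₀ : - (-2 * z) - (-2 * z) - ((n : ℝ) - 2 * (s + t + r + 1 : ℕ)) / 2 = z := by
    push_cast; rw [hn]; ring
  have e₁ : -2 * z + ((n : ℝ) - 2 * (s + t + r + 1 : ℕ)) / 2 = z := by push_cast; rw [hn]; ring
  have e₂ : - (-2 * z - 1) - (-2 * z) - ((n : ℝ) - 2 * (s + t + r : ℕ)) / 2 = z := by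
    push_cast; rw [hn]; ring
  have e₃ : -2 * z - 1 + ((n : ℝ) - 2 * (s + t + r : ℕ)) / 2 = z := by push_cast; rw [hn]; ring
  have e₄ : -2 * z + ((n : ℝ) - 2 * (s + t + r : ℕ)) / 2 = z + 1 := by push_cast; rw [hn]; ring
  have h₁ : coeff n (s + t + r + 1) (-2 * z) (-2 * z) s t =
      z * (z + t + r) * coeff n (s + t + r) (-2 * z - 1) (-2 * z) s t := by
    rw [coeff, coeff, e₀, e₁, e₂, e₃, e₄, show s + t + r + 1 - s = t + r + 1 by omega,
      show s + t + r + 1 - t = s + r + 1 by omega, show s + t + r - s = t + r by omega,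
      show s + t + r - t = s + r by omega, rising_succ, rising_succ' z (s + r)]
    push_cast
    ring
  have h₂ : coeff n (s + t + r + 1) (-2 * z) (-2 * z) (s + 1) t =
      z * (z + s + t) * coeff n (s + t + r) (-2 * z - 1) (-2 * z) s t := by
    rw [coeff, coeff, e₀, e₁, e₂, e₃, e₄, show s + t + r + 1 - (s + 1) = t + r by omega,
      show s + t + r + 1 - t = s + r + 1 by omega, show s + t + r - s = t + r by omega,
      show s + t + r - t = s + r by omega, show s + 1 + t = s + t + 1 by ring, rising_succ,
      rising_succ' z (s + r)]
    push_cast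
    ring
  have h₃ : t * coeff n (s + t + r + 1) (-2 * z) (-2 * z) (s + 1) (t - 1) =
      t * (z * (z + s + r + 1) * coeff n (s + t + r) (-2 * z - 1) (-2 * z) s t) := by
    rcases t with _ | t
    · simp
    rw [coeff, coeff, e₀, e₁, e₂, e₃, e₄, Nat.add_sub_cancel,
      show s + (t + 1) + r + 1 - (s + 1) = t + 1 + r by omega,
      show s + (t + 1) + r + 1 - t = s + r + 1 + 1 by omega,
      show s + (t + 1) + r - s = t + 1 + r by omega,
      show s + (t + 1) + r - (t + 1) = s + r by omega, show s + 1 + t = s + (t + 1) by ring,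
      rising_succ z (s + r + 1), rising_succ' z (s + r)]
    push_cast
    ring
  rw [h₁, h₂, h₃, hn]
  ring

namespace FlatCoordinates

variable {A ι : Type*} [CommRing A] [Algebra ℝ A] [DecidableEq ι] [Fintype ι]
  (C : FlatCoordinates A ι)

/-- The ambient Ovsienko-Redou operator in flat coordinates. -/
def ovsienkoRedou (n k : ℕ) (w₁ w₂ : ℝ) (f g : A) : A :=
  triSum k fun s t => (multinom k s t * coeff n k w₁ w₂ s t) •
    (C.lap ^ (k - s - t)) ((C.lap ^ s) f * (C.lap ^ t) g)

theorem ovsienkoRedou_swap (n k : ℕ) (w₁ w₂ : ℝ) (f g : A) :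
    C.ovsienkoRedou n k w₁ w₂ f g = C.ovsienkoRedou n k w₂ w₁ g f := by
  rw [ovsienkoRedou, triSum_swap, ovsienkoRedou]
  refine triSum_congr fun s t _ => ?_
  rw [multinom_comm, coeff_comm, Nat.sub_right_comm, mul_comm ((C.lap ^ t) f)]

theorem ovsienkoRedou_sub_left (n k : ℕ) (w₁ w₂ : ℝ) (f f' g : A) :
    C.ovsienkoRedou n k w₁ w₂ (f - f') g =
      C.ovsienkoRedou n k w₁ w₂ f g - C.ovsienkoRedou n k w₁ w₂ f' g := by
  rw [eq_sub_iff_add_eq, ovsienkoRedou, ovsienkoRedou, ← triSum_add]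
  refine triSum_congr fun s t _ => ?_
  rw [← smul_add, ← map_add, ← add_mul, ← map_add, sub_add_cancel]

/-- The degree w₁ - 2 of f makes Q f of degree w₁. Passing Q through Δˢ and through the outer power
of Δ leaves two error sums, which cancel term by term. -/
theorem ovsienkoRedou_quad_mul {n : ℕ} (hn : Fintype.card ι = n + 2) (k : ℕ) {w₁ w₂ : ℝ} {f g : A}
    (hf : C.euler f = (w₁ - 2) • f) (hg : C.euler g = w₂ • g) :
    C.ovsienkoRedou n k w₁ w₂ (C.quad * f) g = C.quad * C.ovsienkoRedou n k w₁ w₂ f g := by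
  have hterm : ∀ s t, (C.lap ^ (k - s - t)) ((C.lap ^ s) (C.quad * f) * (C.lap ^ t) g) =
      C.quad * (C.lap ^ (k - s - t)) ((C.lap ^ s) f * (C.lap ^ t) g)
      + (4 * s * (w₁ + n / 2 - s)) •
        (C.lap ^ (k - s - t)) ((C.lap ^ (s - 1)) f * (C.lap ^ t) g)
      + (4 * (k - s - t : ℕ) * (w₁ + w₂ + n / 2 - 2 * s - 2 * t - (k - s - t : ℕ))) •
        (C.lap ^ (k - s - t - 1)) ((C.lap ^ s) f * (C.lap ^ t) g) := by
    intro s t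
    have h := C.euler_mul (C.euler_lap_pow hf s) (C.euler_lap_pow hg t)
    rw [C.lap_pow_quad_mul hf, add_mul, map_add, mul_assoc, C.lap_pow_quad_mul h, smul_mul_assoc,
      map_smul, hn, add_right_comm]
    congr 2
    · congr 1
      push_cast
      ring
    · push_cast
      ring
  rw [← sub_eq_zero, ovsienkoRedou, ovsienkoRedou, ← AddMonoidHom.coe_mulLeft, map_triSum]
  simp only [AddMonoidHom.coe_mulLeft, hterm, smul_add, triSum_add, mul_smul_comm]
  rw [add_assoc, add_sub_cancel_left]
  cases k with
  | zero => simp [triSum]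
  | succ m =>
    -- The inner error carries a factor s and the outer one a factor k - s - t. After s is shifted
    -- by one in the former, both run over s + t ≤ m with the same Laplacian expression.
    rw [triSum_succ_of_left_eq_zero (by simp), triSum_succ_of_diag_eq_zero, ← triSum_add,
      triSum_congr (G := fun _ _ => 0) _]
    · simp [triSum]
    · intro s t hst
      obtain ⟨r, rfl⟩ := Nat.exists_eq_add_of_le hst
      rw [show s + t + r + 1 - (s + 1) - t = r by omega,
        show s + t + r + 1 - s - t - 1 = r by omega, show s + t + r + 1 - s - t = r + 1 by omega,
        Nat.add_sub_cancel, smul_smul, smul_smul, ← add_smul]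
      convert zero_smul ℝ _
      have h₁ := multinom_succ_mul s t r
      have h₂ := multinom_succ_mul_left s t r
      have h₃ := coeff_succ_mul n s t r w₁ w₂
      push_cast
      linear_combination (4 * coeff n (s + t + r + 1) w₁ w₂ (s + 1) t *
          (w₁ + n / 2 - (s + 1))) * h₂
        + 4 * (s + t + r + 1) * multinom (s + t + r) s t * h₃
        + (4 * coeff n (s + t + r + 1) w₁ w₂ s t *
          (w₁ + w₂ + n / 2 - 2 * s - 2 * t - (r + 1))) * h₁
    · intro s t h
      simp [show m + 1 - s - t = 0 by omega]

/-- The three correction sums of `sum_x_mul_lap_pow` are reindexed to the same Laplacian expression.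
The multinomial recursions then extract a common factor m + 1, and `coeff_commutator` does the rest.
-/
theorem sum_x_mul_ovsienkoRedou {n m : ℕ} {w : ℝ} (hw : w = -((n : ℝ) - 2 * (m + 1)) / 3) {f g : A}
    (hf : C.euler f = (w - 1) • f) (hg : C.euler g = w • g) :
    ∑ i, C.ε i • (C.x i * C.ovsienkoRedou n (m + 1) w w (C.x i * f) g) =
      C.quad * C.ovsienkoRedou n (m + 1) w w f g +
      (-(((m : ℝ) + 1) * (n - 2 * (m + 1)) * (n + 2 * (m + 1) - 2) * (n + (m + 1) - 3) / 18)) •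
        C.ovsienkoRedou n m (w - 1) w f g := by
  have hsum : ∑ i, C.ε i • (C.x i * C.ovsienkoRedou n (m + 1) w w (C.x i * f) g) =
      triSum (m + 1) fun s t => (multinom (m + 1) s t * coeff n (m + 1) w w s t) •
        ∑ i, C.ε i • (C.x i * (C.lap ^ (m + 1 - s - t))
          ((C.lap ^ s) (C.x i * f) * (C.lap ^ t) g)) := by
    simp only [ovsienkoRedou, triSum, Finset.mul_sum, Finset.smul_sum]
    rw [Finset.sum_comm]
    refine Finset.sum_congr rfl fun s _ => ?_
    rw [Finset.sum_comm]
    refine Finset.sum_congr rfl fun t _ => Finset.sum_congr rfl fun i _ => ?_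
    rw [mul_smul_comm, smul_comm]
  rw [hsum]
  simp only [C.sum_x_mul_lap_pow hf hg, smul_add, triSum_add]
  rw [add_assoc, add_assoc]
  congr 1
  · simp only [ovsienkoRedou, triSum, Finset.mul_sum, mul_smul_comm]
  rw [triSum_succ_of_diag_eq_zero (fun s t h => by simp [show m + 1 - s - t = 0 by omega]),
    triSum_succ_of_left_eq_zero (by simp),
    triSum_succ_shift (G := fun s t => (2 * (m + 1) * multinom m s t * t *
      coeff n (m + 1) w w (s + 1) (t - 1)) •
        (C.lap ^ (m - s - t)) ((C.lap ^ s) f * (C.lap ^ t) g)) (by simp)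
      (fun s t h => by simp [show m + 1 - s - t = 0 by omega]) (by simp),
    ovsienkoRedou, ← DistribSMul.toAddMonoidHom_apply, map_triSum, ← triSum_add, ← triSum_add]
  · refine triSum_congr fun s t hst => ?_
    obtain ⟨r, rfl⟩ := Nat.exists_eq_add_of_le hst
    simp only [DistribSMul.toAddMonoidHom_apply, Nat.add_sub_cancel]
    rw [show s + t + r + 1 - (s + 1) - t = r by omega,
        show s + t + r + 1 - s - t - 1 = r by omega, show s + t + r + 1 - s - t = r + 1 by omega,
        show s + t + r - s - t = r by omega]
    simp only [smul_smul, ← add_smul]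
    congr 1
    have h₁ := multinom_succ_mul s t r
    have h₂ := multinom_succ_mul_left s t r
    push_cast at hw ⊢
    have h₃ := coeff_commutator n s t r hw
    linear_combination 2 * (2 * w - 2 * (s + t + r) - 1 - s) *
        coeff n (s + t + r + 1) w w s t * h₁
      + 2 * (w - 1 - 2 * s - r) * coeff n (s + t + r + 1) w w (s + 1) t * h₂
      + 2 * (s + t + r + 1) * multinom (s + t + r) s t * h₃
  · intro s t hst
    obtain ⟨r, rfl⟩ := Nat.exists_eq_add_of_le hst
    rw [show s + t + 1 + r + 1 - (s + 1) - t = r + 1 by omega,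
      show s + t + 1 + r - s - (t + 1) = r by omega, smul_smul]
    simp only [Nat.add_sub_cancel]
    congr 1
    have h₁ := multinom_succ_mul_right s t r
    have h₂ := multinom_succ_mul s t r
    have h₃ := multinom_succ_mul_left s t (r + 1)
    rw [show s + t + 1 + r = s + t + r + 1 by ring]
    rw [← add_assoc] at h₃
    push_cast at h₃ ⊢
    linear_combination (2 * coeff n (s + t + r + 1 + 1) w w (s + 1) t) *
      ((s + t + r + 2) * (h₁ - h₂) - (r + 1) * h₃)

end FlatCoordinates

/-! ### Smooth dependence of integrals on parameters -/

section ParametricIntegral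

open Set Topology Filter MeasureTheory

universe u

variable {E G : Type u} [NormedAddCommGroup E] [NormedSpace ℝ E] [NormedAddCommGroup G]
  [NormedSpace ℝ G]

theorem hasFDerivAt_intervalIntegral_of_contDiffOn {F : E × ℝ → G}
    {W : Set (E × ℝ)} (hW : IsOpen W) (hF : ContDiffOn ℝ ∞ F W) {x₀ : E}
    (hx₀ : ∀ t ∈ Icc (0 : ℝ) 1, (x₀, t) ∈ W) :
    HasFDerivAt (fun x => ∫ t in (0 : ℝ)..1, F (x, t))
      (∫ t in (0 : ℝ)..1, (fderiv ℝ F (x₀, t)).comp (ContinuousLinearMap.inl ℝ E ℝ)) x₀ := by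
  have hF' : ContinuousOn (fun p => fderiv ℝ F p) W :=
    hF.continuousOn_fderiv_of_isOpen hW (by simp)
  have hFc : ContinuousOn (fun p => (fderiv ℝ F p).comp (ContinuousLinearMap.inl ℝ E ℝ)) W :=
    hF'.clm_comp continuousOn_const
  have hslice : ∀ x : E, ContinuousOn (fun t : ℝ => (x, t)) (Icc 0 1) := fun x => by fun_prop
  obtain ⟨B, hB⟩ := (isCompact_Icc (a := (0 : ℝ)) (b := 1)).exists_bound_of_continuousOn
    (hFc.comp (hslice x₀) hx₀)
  have hopen : IsOpen (W ∩ (fun p => (fderiv ℝ F p).comp (ContinuousLinearMap.inl ℝ E ℝ)) ⁻¹'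
      (Metric.ball 0 (B + 1))) := hFc.isOpen_inter_preimage hW Metric.isOpen_ball
  -- Compactness of [0, 1] gives one neighbourhood of x₀ on which the derivative is bounded by B + 1
  -- for all t, as dominated differentiation requires.
  obtain ⟨u, v, hu, -, hxu, hv, huv⟩ := generalized_tube_lemma (isCompact_singleton (x := x₀))
    (isCompact_Icc (a := (0 : ℝ)) (b := 1)) hopen (by
      rintro ⟨x, t⟩ ⟨hx, ht⟩
      obtain rfl : x = x₀ := hx
      refine ⟨hx₀ t ht, ?_⟩
      have := hB t ht
      simp only [Function.comp] at this
      simp only [mem_preimage, mem_ball_zero_iff]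
      linarith)
  have hus : u ∈ 𝓝 x₀ := hu.mem_nhds (hxu rfl)
  have hI : uIoc (0 : ℝ) 1 ⊆ Icc 0 1 := by
    rw [uIoc_of_le zero_le_one]
    exact Ioc_subset_Icc_self
  have hcont : ∀ x ∈ u, ContinuousOn (fun t => F (x, t)) (Icc 0 1) := fun x hx =>
    hF.continuousOn.comp (hslice x) fun t ht => (huv ⟨hx, hv ht⟩).1
  refine intervalIntegral.hasFDerivAt_integral_of_dominated_of_fderiv_le
    (F' := fun x t => (fderiv ℝ F (x, t)).comp (ContinuousLinearMap.inl ℝ E ℝ))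
    (bound := fun _ => B + 1) hus ?_ ?_ ?_ ?_ ?_ ?_
  · filter_upwards [hus] with x hx
    exact ((hcont x hx).mono hI).aestronglyMeasurable measurableSet_uIoc
  · refine ContinuousOn.intervalIntegrable ?_
    rw [uIcc_of_le zero_le_one]
    exact hcont x₀ (hxu rfl)
  · exact ((hFc.comp (hslice x₀) hx₀).mono hI).aestronglyMeasurable measurableSet_uIoc
  · refine Eventually.of_forall fun t ht x hx => ?_
    have := (huv (mk_mem_prod hx (hv (hI ht)))).2
    simp only [mem_preimage, mem_ball_zero_iff] at this
    exact this.le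
  · exact intervalIntegrable_const
  · refine Eventually.of_forall fun t ht x hx => ?_
    have hmem := (huv (mk_mem_prod hx (hv (hI ht)))).1
    have hd : HasFDerivAt F (fderiv ℝ F (x, t)) (x, t) :=
      ((hF.contDiffAt (hW.mem_nhds hmem)).differentiableAt (by simp)).hasFDerivAt
    exact hd.comp x (hasFDerivAt_prodMk_left x t)

theorem contDiffOn_intervalIntegral {F : E × ℝ → G} {W : Set (E × ℝ)} (hW : IsOpen W)
    (hF : ContDiffOn ℝ ∞ F W) {U : Set E} (hU : IsOpen U)
    (hUW : ∀ x ∈ U, ∀ t ∈ Icc (0 : ℝ) 1, (x, t) ∈ W) :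
    ContDiffOn ℝ ∞ (fun x => ∫ t in (0 : ℝ)..1, F (x, t)) U := by
  rw [contDiffOn_infty]
  intro m
  induction m generalizing G with
  | zero =>
    rw [Nat.cast_zero, contDiffOn_zero]
    exact fun x hx => (hasFDerivAt_intervalIntegral_of_contDiffOn hW hF
      (hUW x hx)).continuousAt.continuousWithinAt
  | succ m ih =>
    rw [Nat.cast_succ, contDiffOn_succ_iff_hasFDerivWithinAt_of_uniqueDiffOn hU.uniqueDiffOn]
    refine ⟨by simp, _, ?_, fun x hx => (hasFDerivAt_intervalIntegral_of_contDiffOn hW hF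
      (hUW x hx)).hasFDerivWithinAt⟩
    exact ih (F := fun p => (fderiv ℝ F p).comp (ContinuousLinearMap.inl ℝ E ℝ))
      ((hF.fderiv_of_isOpen hW (by simp)).clm_comp contDiffOn_const)

end ParametricIntegral

/-! ### The ambient domain -/

theorem isOpen_ambientDomain (n : ℕ) : IsOpen (ambientDomain n) :=
  (isOpen_ne.preimage continuous_fst).inter (isOpen_lt continuous_const continuous_snd)

theorem norm_eq_one {n : ℕ} (x : Sph n) : ‖x.1‖ = 1 := mem_sphere_zero_iff_norm.mp x.2

theorem mem_ambientDomain {n : ℕ} (x : Sph n) : ((x.1, 1) : Minkowski n) ∈ ambientDomain n :=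
  ⟨norm_ne_zero_iff.mp (by rw [norm_eq_one]; exact one_ne_zero), zero_lt_one⟩

/-- A smooth function that vanishes on the null cone is divisible by the quadratic form. -/
theorem exists_eq_quad_mul {n : ℕ} {f : Minkowski n → ℝ}
    (hf : ContDiffOn ℝ ∞ f (ambientDomain n))
    (h₀ : ∀ p ∈ ambientDomain n, ‖p.1‖ = p.2 → f p = 0) :
    ∃ h : Minkowski n → ℝ, ContDiffOn ℝ ∞ h (ambientDomain n) ∧
      ∀ p ∈ ambientDomain n, f p = (‖p.1‖ ^ 2 - p.2 ^ 2) * h p := by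
  have hΩ := isOpen_ambientDomain n
  -- Hadamard's lemma along the vertical segment from (x, |x|) on the cone to (x, τ), which stays in
  -- the domain: f = (τ - |x|) ∫ ∂_τ f, and τ - |x| = -Q / (|x| + τ).
  let γ : Minkowski n × ℝ → Minkowski n := fun q =>
    (q.1.1, ‖q.1.1‖ + q.2 * (q.1.2 - ‖q.1.1‖))
  have hγc : Continuous γ := by fun_prop
  let W : Set (Minkowski n × ℝ) := γ ⁻¹' ambientDomain n
  have hW : IsOpen W := hΩ.preimage hγc
  have hγ : ContDiffOn ℝ ∞ γ W := by
    intro q hq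
    have hn : ContDiffAt ℝ ∞ (fun q : Minkowski n × ℝ => ‖q.1.1‖) q :=
      (contDiffAt_norm ℝ (show q.1.1 ≠ 0 from hq.1)).comp q
        (contDiff_fst.comp contDiff_fst).contDiffAt
    refine ContDiffAt.contDiffWithinAt ?_
    exact (contDiff_fst.comp contDiff_fst).contDiffAt.prodMk
      (hn.add (contDiffAt_snd.mul ((contDiff_snd.comp contDiff_fst).contDiffAt.sub hn)))
  have hdf : ContDiffOn ℝ ∞ (fun q => fderiv ℝ f (γ q) (0, 1)) W :=
    ((hf.fderiv_of_isOpen hΩ (m := ∞) (by simp)).comp hγ fun q hq => hq).clm_apply contDiffOn_const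
  have hUW : ∀ p ∈ ambientDomain n, ∀ t ∈ Set.Icc (0 : ℝ) 1, (p, t) ∈ W := by
    rintro ⟨x, τ⟩ ⟨hx, hτ⟩ t ⟨ht₀, ht₁⟩
    refine ⟨hx, ?_⟩
    have hx' : 0 < ‖x‖ := norm_pos_iff.mpr hx
    change 0 < τ at hτ
    change 0 < ‖x‖ + t * (τ - ‖x‖)
    rcases ht₀.eq_or_lt with rfl | ht
    · simpa using hx'
    · nlinarith [mul_pos ht hτ, mul_nonneg (sub_nonneg.mpr ht₁) hx'.le]
  have hnorm : ContDiffOn ℝ ∞ (fun p : Minkowski n => ‖p.1‖) (ambientDomain n) := fun p hp =>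
    ((contDiffAt_norm ℝ (show p.1 ≠ 0 from hp.1)).comp p contDiffAt_fst).contDiffWithinAt
  have hpos : ∀ p ∈ ambientDomain n, ‖p.1‖ + p.2 ≠ 0 := fun p hp =>
    (add_pos_of_nonneg_of_pos (norm_nonneg _) hp.2).ne'
  refine ⟨fun p => -(∫ t in (0 : ℝ)..1, fderiv ℝ f (γ (p, t)) (0, 1)) / (‖p.1‖ + p.2),
    (contDiffOn_intervalIntegral hW hdf hΩ hUW).neg.div
      (hnorm.add contDiff_snd.contDiffOn) hpos, ?_⟩
  rintro ⟨x, τ⟩ hp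
  have hder : ∀ t ∈ Set.uIcc (0 : ℝ) 1, HasDerivAt (fun t => f (γ ((x, τ), t)))
      ((τ - ‖x‖) * fderiv ℝ f (γ ((x, τ), t)) (0, 1)) t := by
    intro t ht
    rw [Set.uIcc_of_le zero_le_one] at ht
    have hd : HasFDerivAt f (fderiv ℝ f (γ ((x, τ), t))) (γ ((x, τ), t)) :=
      ((hf.contDiffAt (hΩ.mem_nhds (hUW _ hp t ht))).differentiableAt (by simp)).hasFDerivAt
    have hγ' : HasDerivAt (fun t => γ ((x, τ), t)) ((τ - ‖x‖) • ((0 : _), (1 : ℝ))) t := by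
      have : HasDerivAt (fun t : ℝ => ‖x‖ + t * (τ - ‖x‖)) (1 * (τ - ‖x‖)) t :=
        ((hasDerivAt_id t).mul_const _).const_add _
      convert (hasDerivAt_const t x).prodMk this using 1
      simp
    have := hd.comp_hasDerivAt t hγ'
    rwa [map_smul, smul_eq_mul] at this
  have hint : ∫ t in (0 : ℝ)..1, (τ - ‖x‖) * fderiv ℝ f (γ ((x, τ), t)) (0, 1) = f (x, τ) := by
    rw [intervalIntegral.integral_eq_sub_of_hasDerivAt hder]
    · have h₁ : f (x, ‖x‖) = 0 := h₀ _ ⟨hp.1, norm_pos_iff.mpr hp.1⟩ rfl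
      simp [γ, h₁]
    · refine ContinuousOn.intervalIntegrable ?_
      rw [Set.uIcc_of_le zero_le_one]
      exact continuousOn_const.mul (hdf.continuousOn.comp (by fun_prop) (hUW _ hp))
  rw [intervalIntegral.integral_const_mul] at hint
  rw [← hint]
  have := hpos _ hp
  field_simp
  ring

/-! ### The algebra of smooth functions on the ambient domain -/

variable {n : ℕ}

theorem contDiffOn_dirDeriv {f : Minkowski n → ℝ} (hf : ContDiffOn ℝ ∞ f (ambientDomain n))
    (v : Minkowski n) : ContDiffOn ℝ ∞ (dirDeriv v f) (ambientDomain n) :=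
  (hf.fderiv_of_isOpen (isOpen_ambientDomain n) (m := ∞) (by simp)).clm_apply contDiffOn_const

theorem dirDeriv_congr {f g : Minkowski n → ℝ} (h : Set.EqOn f g (ambientDomain n))
    (v : Minkowski n) : Set.EqOn (dirDeriv v f) (dirDeriv v g) (ambientDomain n) := fun p hp => by
  have : f =ᶠ[nhds p] g := h.eventuallyEq_of_mem ((isOpen_ambientDomain n).mem_nhds hp)
  rw [dirDeriv, dirDeriv, this.fderiv_eq]

theorem differentiableAt_of_contDiffOn {f : Minkowski n → ℝ}
    (hf : ContDiffOn ℝ ∞ f (ambientDomain n)) {p : Minkowski n} (hp : p ∈ ambientDomain n) :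
    DifferentiableAt ℝ f p :=
  (hf.contDiffAt ((isOpen_ambientDomain n).mem_nhds hp)).differentiableAt (by simp)

theorem dirDeriv_comm {f : Minkowski n → ℝ} (hf : ContDiffOn ℝ ∞ f (ambientDomain n))
    (v v' : Minkowski n) {p : Minkowski n} (hp : p ∈ ambientDomain n) :
    dirDeriv v (dirDeriv v' f) p = dirDeriv v' (dirDeriv v f) p := by
  have hnhds := (isOpen_ambientDomain n).mem_nhds hp
  have hd : DifferentiableAt ℝ (fderiv ℝ f) p :=
    ((hf.fderiv_of_isOpen (isOpen_ambientDomain n) (m := ∞) (by simp)).contDiffAt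
      hnhds).differentiableAt (by simp)
  have h : ∀ a b : Minkowski n, dirDeriv a (dirDeriv b f) p = fderiv ℝ (fderiv ℝ f) p a b := by
    intro a b
    have := (hd.hasFDerivAt.clm_apply (hasFDerivAt_const b p)).fderiv
    change fderiv ℝ (fun q => fderiv ℝ f q b) p a = _
    rw [this]
    simp
  rw [h, h]
  exact (hf.contDiffAt hnhds).isSymmSndFDerivAt
    (by simpa using ENat.LEInfty.out) v v'

variable (n) in
/-- The algebra of smooth functions on the ambient domain. -/
def SmoothFun : Subalgebra ℝ (ambientDomain n → ℝ) where
  carrier := {f | ∃ F : Minkowski n → ℝ, ContDiffOn ℝ ∞ F (ambientDomain n) ∧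
    f = (ambientDomain n).domRestrict F}
  mul_mem' := by
    rintro _ _ ⟨F, hF, rfl⟩ ⟨G, hG, rfl⟩
    exact ⟨fun p => F p * G p, hF.mul hG, rfl⟩
  add_mem' := by
    rintro _ _ ⟨F, hF, rfl⟩ ⟨G, hG, rfl⟩
    exact ⟨fun p => F p + G p, hF.add hG, rfl⟩
  algebraMap_mem' r := ⟨fun _ => r, contDiffOn_const, rfl⟩

/-- The ambient function `F` is smooth on the ambient domain, where it agrees with `a`. -/
def Represents (F : Minkowski n → ℝ) (a : SmoothFun n) : Prop :=
  ContDiffOn ℝ ∞ F (ambientDomain n) ∧ a.1 = (ambientDomain n).domRestrict F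

/-- The restriction of a smooth function to the ambient domain. -/
def SmoothFun.mk (F : Minkowski n → ℝ) (hF : ContDiffOn ℝ ∞ F (ambientDomain n)) : SmoothFun n :=
  ⟨(ambientDomain n).domRestrict F, F, hF, rfl⟩

theorem represents_mk {F : Minkowski n → ℝ} (hF : ContDiffOn ℝ ∞ F (ambientDomain n)) :
    Represents F (SmoothFun.mk F hF) := ⟨hF, rfl⟩

theorem exists_represents (a : SmoothFun n) : ∃ F, Represents F a := a.2

namespace Represents

variable {F G : Minkowski n → ℝ} {a b : SmoothFun n}

theorem apply (h : Represents F a) (p : ambientDomain n) : a.1 p = F p := by rw [h.2]; rfl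

theorem eqOn (h : Represents F a) (h' : Represents G a) : Set.EqOn F G (ambientDomain n) :=
  fun p hp => (h.apply ⟨p, hp⟩).symm.trans (h'.apply ⟨p, hp⟩)

theorem eq_of_eqOn (hF : Represents F a) (hG : Represents G b)
    (h : Set.EqOn F G (ambientDomain n)) : a = b :=
  Subtype.ext <| funext fun p => by rw [hF.apply, hG.apply, h p.2]

theorem add (hF : Represents F a) (hG : Represents G b) :
    Represents (fun p => F p + G p) (a + b) :=
  ⟨hF.1.add hG.1, funext fun p => congrArg₂ (· + ·) (hF.apply p) (hG.apply p)⟩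

theorem sub (hF : Represents F a) (hG : Represents G b) :
    Represents (fun p => F p - G p) (a - b) :=
  ⟨hF.1.sub hG.1, funext fun p => congrArg₂ (· - ·) (hF.apply p) (hG.apply p)⟩

theorem mul (hF : Represents F a) (hG : Represents G b) :
    Represents (fun p => F p * G p) (a * b) :=
  ⟨hF.1.mul hG.1, funext fun p => congrArg₂ (· * ·) (hF.apply p) (hG.apply p)⟩

theorem const_smul (hF : Represents F a) (c : ℝ) : Represents (fun p => c * F p) (c • a) :=
  ⟨contDiffOn_const.mul hF.1, funext fun p => congrArg (c * ·) (hF.apply p)⟩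

theorem sum {κ : Type*} {s : Finset κ} {F : κ → Minkowski n → ℝ} {a : κ → SmoothFun n}
    (h : ∀ i ∈ s, Represents (F i) (a i)) :
    Represents (fun p => ∑ i ∈ s, F i p) (∑ i ∈ s, a i) := by
  classical
  induction s using Finset.induction_on with
  | empty => exact ⟨by simpa using contDiffOn_const, by simp; rfl⟩
  | insert i s hi ih =>
    simp only [Finset.sum_insert hi]
    exact (h i (Finset.mem_insert_self _ _)).add
      (ih fun j hj => h j (Finset.mem_insert_of_mem hj))

end Represents

/-- The directional derivative as a derivation of the algebra of smooth functions. -/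
def dirDerivation (v : Minkowski n) : Derivation ℝ (SmoothFun n) (SmoothFun n) := by
  -- The chosen representative does not matter: the domain is open, so values on it determine
  -- derivatives there.
  let φ : SmoothFun n → SmoothFun n := fun a =>
    SmoothFun.mk (dirDeriv v (exists_represents a).choose)
      (contDiffOn_dirDeriv (exists_represents a).choose_spec.1 v)
  have hφ : ∀ {F a}, Represents F a → Represents (dirDeriv v F) (φ a) := fun {F a} h => by
    refine ⟨contDiffOn_dirDeriv h.1 v, funext fun p => ?_⟩
    exact dirDeriv_congr ((exists_represents a).choose_spec.eqOn h) v p.2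
  refine Derivation.mk'
    { toFun := φ
      map_add' := fun a b => ?_
      map_smul' := fun c a => ?_ } fun a b => ?_
  · obtain ⟨F, hF⟩ := exists_represents a
    obtain ⟨G, hG⟩ := exists_represents b
    refine (hφ (hF.add hG)).eq_of_eqOn ((hφ hF).add (hφ hG)) fun p hp => ?_
    simp only [dirDeriv]
    rw [fderiv_fun_add (differentiableAt_of_contDiffOn hF.1 hp)
      (differentiableAt_of_contDiffOn hG.1 hp)]
    rfl
  · obtain ⟨F, hF⟩ := exists_represents a
    refine (hφ (hF.const_smul c)).eq_of_eqOn ((hφ hF).const_smul c) fun p hp => ?_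
    simp only [dirDeriv]
    rw [fderiv_const_mul (differentiableAt_of_contDiffOn hF.1 hp)]
    rfl
  · obtain ⟨F, hF⟩ := exists_represents a
    obtain ⟨G, hG⟩ := exists_represents b
    refine (hφ (hF.mul hG)).eq_of_eqOn ((hF.mul (hφ hG)).add (hG.mul (hφ hF))) fun p hp => ?_
    simp only [dirDeriv]
    rw [fderiv_fun_mul (differentiableAt_of_contDiffOn hF.1 hp)
      (differentiableAt_of_contDiffOn hG.1 hp)]
    rfl

theorem Represents.dirDeriv {F : Minkowski n → ℝ} {a : SmoothFun n} (h : Represents F a)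
    (v : Minkowski n) : Represents (dirDeriv v F) (dirDerivation v a) := by
  refine ⟨contDiffOn_dirDeriv h.1 v, funext fun p => ?_⟩
  exact dirDeriv_congr ((exists_represents a).choose_spec.eqOn h) v p.2

/-- The coordinate directions of Minkowski space. -/
def basisVector : Fin (n + 1) ⊕ Unit → Minkowski n
  | .inl i => (EuclideanSpace.single i 1, 0)
  | .inr _ => (0, 1)

/-- The coordinate functions of Minkowski space. -/
def coordFun : Fin (n + 1) ⊕ Unit → Minkowski n →L[ℝ] ℝ
  | .inl i => (EuclideanSpace.proj i).comp (ContinuousLinearMap.fst ℝ _ _)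
  | .inr _ => ContinuousLinearMap.snd ℝ _ _

theorem sum_coordFun_smul_basisVector (p : Minkowski n) :
    ∑ i, coordFun i p • basisVector i = p := by
  rw [Fintype.sum_sum_type]
  simp only [coordFun, basisVector]
  refine Prod.ext ?_ ?_
  · ext j
    simp [Prod.fst_sum, Finset.sum_apply, Pi.single_apply]
  · simp [Prod.snd_sum]

theorem represents_coordFun (i : Fin (n + 1) ⊕ Unit) :
    Represents (coordFun i) (SmoothFun.mk (coordFun i : Minkowski n → ℝ)
      (coordFun i).contDiff.contDiffOn) := represents_mk _

variable (n) in
/-- The Minkowski coordinates on the ambient domain. -/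
def minkowskiCoordinates : FlatCoordinates (SmoothFun n) (Fin (n + 1) ⊕ Unit) where
  d i := dirDerivation (basisVector i)
  x i := SmoothFun.mk (coordFun i) (coordFun i).contDiff.contDiffOn
  ε := Sum.elim (fun _ => 1) (fun _ => -1)
  d_comm i j a := by
    obtain ⟨F, hF⟩ := exists_represents a
    exact ((hF.dirDeriv _).dirDeriv _).eq_of_eqOn ((hF.dirDeriv _).dirDeriv _)
      fun p hp => dirDeriv_comm hF.1 _ _ hp
  d_x i j := by
    have hc : Represents (fun _ : Minkowski n => (if i = j then (1 : ℝ) else 0))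
        (if i = j then 1 else 0) := by
      refine ⟨contDiffOn_const, ?_⟩
      split_ifs <;> rfl
    refine ((represents_coordFun j).dirDeriv _).eq_of_eqOn hc fun p _ => ?_
    simp only [OvsienkoRedou.dirDeriv, (coordFun j).fderiv]
    rcases i with i | i <;> rcases j with j | j <;>
      simp [coordFun, basisVector, PiLp.single_apply, eq_comm]
  ε_mul_ε i := by rcases i with i | i <;> simp

theorem Represents.lap {F : Minkowski n → ℝ} {a : SmoothFun n} (h : Represents F a) :
    Represents (ambientLaplacian F) ((minkowskiCoordinates n).lap a) := by
  rw [FlatCoordinates.lap_apply, Fintype.sum_sum_type]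
  simp only [minkowskiCoordinates, Sum.elim_inl, Sum.elim_inr, one_smul, neg_smul,
    Finset.sum_neg_distrib, ← sub_eq_add_neg]
  refine (Represents.sum fun i _ => (h.dirDeriv _).dirDeriv _).sub ?_
  rw [Finset.univ_unique, Finset.sum_singleton]
  exact (h.dirDeriv _).dirDeriv _

theorem Represents.lap_pow {F : Minkowski n → ℝ} {a : SmoothFun n} (h : Represents F a) (r : ℕ) :
    Represents (ambientLaplacian^[r] F) (((minkowskiCoordinates n).lap ^ r) a) := by
  induction r with
  | zero => simpa using h
  | succ r ih =>
    rw [Function.iterate_succ_apply', FlatCoordinates.lap_pow_succ]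
    exact ih.lap

theorem Represents.ambientOperator {F G : Minkowski n → ℝ} {a b : SmoothFun n}
    (hF : Represents F a) (hG : Represents G b) (k : ℕ) (w₁ w₂ : ℝ) :
    Represents (ambientOperator n k w₁ w₂ F G)
      ((minkowskiCoordinates n).ovsienkoRedou n k w₁ w₂ a b) :=
  Represents.sum fun _ _ => Represents.sum fun _ _ =>
    (((hF.lap_pow _).mul (hG.lap_pow _)).lap_pow _).const_smul _

theorem represents_quad :
    Represents (fun p : Minkowski n => ‖p.1‖ ^ 2 - p.2 ^ 2) (minkowskiCoordinates n).quad := by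
  have h : Represents _ (minkowskiCoordinates n).quad := Represents.sum fun i _ =>
    ((represents_coordFun i).mul (represents_coordFun i)).const_smul _
  convert h using 2 with p
  rw [Fintype.sum_sum_type, EuclideanSpace.norm_sq_eq]
  simp [minkowskiCoordinates, coordFun, sq, sub_eq_add_neg]

theorem Represents.euler {F : Minkowski n → ℝ} {a : SmoothFun n} (h : Represents F a) :
    Represents (fun p => fderiv ℝ F p p) ((minkowskiCoordinates n).euler a) := by
  rw [FlatCoordinates.euler_apply]
  have h' : Represents _ (∑ i, (minkowskiCoordinates n).x i * (minkowskiCoordinates n).d i a) :=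
    Represents.sum fun i _ => (represents_coordFun i).mul (h.dirDeriv _)
  convert h' using 2 with p
  conv_lhs => rw [← sum_coordFun_smul_basisVector p, map_sum]
  simp only [map_smul, smul_eq_mul, sum_coordFun_smul_basisVector]
  rfl

/-- Euler's identity for homogeneous functions. -/
theorem Represents.euler_eq {F : Minkowski n → ℝ} {a : SmoothFun n} (h : Represents F a) {w : ℝ}
    (hF : IsHomogeneous w F) : (minkowskiCoordinates n).euler a = w • a := by
  refine h.euler.eq_of_eqOn (h.const_smul w) fun p hp => ?_
  have h₁ : HasDerivAt (fun c : ℝ => F (c • p)) (fderiv ℝ F p p) 1 := by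
    have hd : HasFDerivAt F (fderiv ℝ F p) ((1 : ℝ) • p) := by
      rw [one_smul]
      exact (differentiableAt_of_contDiffOn h.1 hp).hasFDerivAt
    have hs : HasDerivAt (fun c : ℝ => c • p) p 1 := by
      simpa using (hasDerivAt_id (1 : ℝ)).smul_const p
    exact hd.comp_hasDerivAt 1 hs
  have h₂ : HasDerivAt (fun c : ℝ => F (c • p)) (w * F p) 1 := by
    have hs : HasDerivAt (fun c : ℝ => c ^ w * F p) (w * (1 : ℝ) ^ (w - 1) * F p) 1 :=
      (Real.hasDerivAt_rpow_const (Or.inl one_ne_zero)).mul_const _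
    rw [Real.one_rpow, mul_one] at hs
    refine hs.congr_of_eventuallyEq ?_
    filter_upwards [lt_mem_nhds (zero_lt_one' ℝ)] with c hc
    exact hF.homogeneous c hc p hp
  exact h₁.unique h₂

/-- Off the cone Q is invertible; a point of the cone is a limit of such points in the τ direction,
and continuity concludes. -/
theorem eq_zero_of_quad_mul_eq_zero {a : SmoothFun n}
    (h : (minkowskiCoordinates n).quad * a = 0) : a = 0 := by
  obtain ⟨F, hF⟩ := exists_represents a
  have h₀ : Represents (fun _ : Minkowski n => (0 : ℝ)) (0 : SmoothFun n) :=
    ⟨contDiffOn_const, rfl⟩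
  refine hF.eq_of_eqOn h₀ fun p hp => ?_
  have hQ : ∀ q ∈ ambientDomain n, (‖q.1‖ ^ 2 - q.2 ^ 2) * F q = 0 :=
    (h ▸ represents_quad.mul hF).eqOn h₀
  have hγ : Filter.Tendsto (fun t : ℝ => (p.1, t)) (nhdsWithin p.2 {p.2}ᶜ) (nhds p) :=
    ((Continuous.prodMk_right p.1).tendsto p.2).mono_left nhdsWithin_le_nhds
  have hcont := (hF.1.continuousOn.continuousAt ((isOpen_ambientDomain n).mem_nhds hp)).tendsto
  by_cases hc : ‖p.1‖ = p.2
  · refine tendsto_nhds_unique (hcont.comp hγ) (tendsto_const_nhds.congr' ?_)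
    have hpos : ∀ᶠ t in nhdsWithin p.2 {p.2}ᶜ, 0 < t :=
      (lt_mem_nhds hp.2).filter_mono nhdsWithin_le_nhds
    filter_upwards [hpos, self_mem_nhdsWithin] with t ht htne
    refine (((mul_eq_zero.mp (hQ (p.1, t) ⟨hp.1, ht⟩)).resolve_left ?_)).symm
    intro h0
    exact htne (((sq_eq_sq₀ (norm_nonneg _) ht.le).mp (sub_eq_zero.mp h0)).symm.trans hc)
  · refine (mul_eq_zero.mp (hQ p hp)).resolve_left fun h0 => hc ?_
    exact (sq_eq_sq₀ (norm_nonneg _) hp.2.le).mp (sub_eq_zero.mp h0)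

/-! ### Tangentiality -/

theorem contMDiff_restrict {f : Minkowski n → ℝ} (hf : ContDiffOn ℝ ∞ f (ambientDomain n)) :
    ContMDiff (𝓡 n) 𝓘(ℝ, ℝ) ∞ (restrict f) := by
  have := Fact.mk (@finrank_euclideanSpace_fin ℝ _ (n + 1))
  intro x
  have hc : ContMDiffAt (𝓡 n) 𝓘(ℝ, EuclideanSpace ℝ (Fin (n + 1))) ∞
      (fun y : Sph n => y.1) x := (contMDiff_coe_sphere x)
  have hf' : ContDiffAt ℝ ∞ (fun y : EuclideanSpace ℝ (Fin (n + 1)) => f (y, 1)) x.1 :=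
    (hf.contDiffAt ((isOpen_ambientDomain n).mem_nhds (mem_ambientDomain x))).comp x.1
      (contDiffAt_id.prodMk contDiffAt_const)
  exact hf'.contMDiffAt.comp x hc

/-- Dilation by τ carries the section τ = 1 to the point p, so values on the sphere determine f on
the whole cone. -/
theorem IsHomogeneous.eq_of_mem_cone {f : Minkowski n → ℝ} {w : ℝ} (hf : IsHomogeneous w f)
    {p : Minkowski n} (hp : p ∈ ambientDomain n) (hc : ‖p.1‖ = p.2) :
    f p = p.2 ^ w * restrict f ⟨p.2⁻¹ • p.1, by
      rw [mem_sphere_zero_iff_norm, norm_smul, norm_inv, Real.norm_of_nonneg hp.2.le, hc,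
        inv_mul_cancel₀ hp.2.ne']⟩ := by
  rw [restrict, ← hf.homogeneous _ hp.2 _ (mem_ambientDomain _)]
  congr 1
  refine Prod.ext ?_ ?_
  · simp [smul_smul, mul_inv_cancel₀ hp.2.ne']
  · simp

/-- Two homogeneous functions with the same restriction to the sphere differ by a multiple of the
quadratic form. -/
theorem exists_sub_eq_quad_mul {f f' : Minkowski n → ℝ} {w : ℝ} {a a' : SmoothFun n}
    (ha : Represents f a) (ha' : Represents f' a')
    (hf : IsHomogeneous w f) (hf' : IsHomogeneous w f') (h : restrict f = restrict f') :
    ∃ b : SmoothFun n, a - a' = (minkowskiCoordinates n).quad * b ∧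
      (minkowskiCoordinates n).euler b = (w - 2) • b := by
  set C := minkowskiCoordinates n
  obtain ⟨g, hg, hfg⟩ := exists_eq_quad_mul (hf.smooth.sub hf'.smooth) fun p hp hc => by
    rw [hf.eq_of_mem_cone hp hc, hf'.eq_of_mem_cone hp hc, h, sub_self]
  have hb := represents_mk hg
  have hab : a - a' = C.quad * SmoothFun.mk g hg :=
    (ha.sub ha').eq_of_eqOn (represents_quad.mul hb) hfg
  refine ⟨_, hab, ?_⟩
  -- Since E Q = 2Q, cancelling Q in E(Qb) = w Q b gives the degree of b.
  have he : C.euler (a - a') = w • (a - a') := by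
    rw [map_sub, ha.euler_eq hf, ha'.euler_eq hf', smul_sub]
  rw [← sub_eq_zero]
  apply eq_zero_of_quad_mul_eq_zero
  rw [hab, Derivation.leibniz, C.euler_quad] at he
  simp only [smul_eq_mul, Algebra.smul_def, map_sub] at he ⊢
  linear_combination he

theorem ambientOperator_eq_of_restrict_eq (k : ℕ) {w₁ w₂ : ℝ} {f f' g g' : Minkowski n → ℝ}
    (hf : IsHomogeneous w₁ f) (hf' : IsHomogeneous w₁ f') (hg : IsHomogeneous w₂ g)
    (hg' : IsHomogeneous w₂ g') (h₁ : restrict f = restrict f') (h₂ : restrict g = restrict g') :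
    restrict (ambientOperator n k w₁ w₂ f g) = restrict (ambientOperator n k w₁ w₂ f' g') := by
  set C := minkowskiCoordinates n
  have rf := represents_mk hf.smooth
  have rf' := represents_mk hf'.smooth
  have rg := represents_mk hg.smooth
  have rg' := represents_mk hg'.smooth
  have hcard : Fintype.card (Fin (n + 1) ⊕ Unit) = n + 2 := by simp
  obtain ⟨a, ha, hae⟩ := exists_sub_eq_quad_mul rf rf' hf hf' h₁
  obtain ⟨b, hb, hbe⟩ := exists_sub_eq_quad_mul rg rg' hg hg' h₂
  -- Telescoping D(f, g) - D(f', g') = D(f - f', g) + D(f', g - g'); the swap symmetry reduces the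
  -- second slot to the first.
  have key : C.ovsienkoRedou n k w₁ w₂ (SmoothFun.mk f hf.smooth) (SmoothFun.mk g hg.smooth) -
      C.ovsienkoRedou n k w₁ w₂ (SmoothFun.mk f' hf'.smooth) (SmoothFun.mk g' hg'.smooth) =
      C.quad * (C.ovsienkoRedou n k w₁ w₂ a (SmoothFun.mk g hg.smooth)
        + C.ovsienkoRedou n k w₂ w₁ b (SmoothFun.mk f' hf'.smooth)) := by
    rw [mul_add, ← C.ovsienkoRedou_quad_mul hcard k hae (rg.euler_eq hg),
      ← C.ovsienkoRedou_quad_mul hcard k hbe (rf'.euler_eq hf'), ← ha, ← hb,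
      C.ovsienkoRedou_sub_left, C.ovsienkoRedou_sub_left, C.ovsienkoRedou_swap n k w₂ w₁,
      C.ovsienkoRedou_swap n k w₂ w₁]
    ring
  obtain ⟨G, hG⟩ := exists_represents (C.ovsienkoRedou n k w₁ w₂ a (SmoothFun.mk g hg.smooth)
        + C.ovsienkoRedou n k w₂ w₁ b (SmoothFun.mk f' hf'.smooth))
  funext x
  have := (key ▸ (rf.ambientOperator rg k w₁ w₂).sub (rf'.ambientOperator rg' k w₁ w₂)).eqOn
    (represents_quad.mul hG) (mem_ambientDomain x)
  simp only [norm_eq_one, sub_self, one_pow, zero_mul] at this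
  exact sub_eq_zero.mp this

/-- The Ovsienko-Redou operators are tangential. -/
theorem induces_sphereOperator (n k : ℕ) (w₁ w₂ : ℝ) :
    Induces (ambientOperator n k w₁ w₂) w₁ w₂ (sphereOperator n k w₁ w₂) := fun _ _ hf hg =>
  ambientOperator_eq_of_restrict_eq k hf (isHomogeneous_extend w₁ _ (contMDiff_restrict hf.smooth))
    hg (isHomogeneous_extend w₂ _ (contMDiff_restrict hg.smooth)) (restrict_extend _ _).symm
    (restrict_extend _ _).symm

/-! ### The commutator formula -/

theorem IsHomogeneous.coordFun_mul {f : Minkowski n → ℝ} {w : ℝ} (hf : IsHomogeneous (w - 1) f)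
    (i : Fin (n + 1) ⊕ Unit) : IsHomogeneous w (fun p => coordFun i p * f p) where
  smooth := (coordFun i).contDiff.contDiffOn.mul hf.smooth
  homogeneous c hc p hp := by
    rw [hf.homogeneous c hc p hp, map_smul, smul_eq_mul, Real.rpow_sub_one hc.ne']
    field_simp

theorem sum_coord_mul_commutator {n m : ℕ} {w : ℝ} (hw : w = -((n : ℝ) - 2 * (m + 1)) / 3)
    {u v : Sph n → ℝ} (hu : ContMDiff (𝓡 n) 𝓘(ℝ, ℝ) ∞ u) (hv : ContMDiff (𝓡 n) 𝓘(ℝ, ℝ) ∞ v)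
    (x : Sph n) :
    ∑ i : Fin (n + 1), coord i x * commutator (sphereOperator n (m + 1) w w) (coord i) u v x =
      -(((m : ℝ) + 1) * (n - 2 * (m + 1)) * (n + 2 * (m + 1) - 2) * (n + (m + 1) - 3) / 18) *
        sphereOperator n m (w - 1) w u v x := by
  set C := minkowskiCoordinates n
  -- Degree w - 1 rather than w, so that multiplication by a coordinate gives the degree on which
  -- the operator acts.
  have hU := isHomogeneous_extend (w - 1) u hu
  have hV := isHomogeneous_extend w v hv
  have hp := mem_ambientDomain x
  have hD : ∀ i, restrict (ambientOperator n (m + 1) w w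
      (fun p => coordFun i p * extend (w - 1) u p) (extend w v)) x =
      sphereOperator n (m + 1) w w (restrict fun p => coordFun i p * extend (w - 1) u p) v x := by
    intro i
    rw [induces_sphereOperator n (m + 1) w w _ _ (hU.coordFun_mul i) hV, restrict_extend]
  have hinl : ∀ i, (restrict fun p : Minkowski n => coordFun (.inl i) p * extend (w - 1) u p) =
      u * coord i := by
    intro i
    funext y
    rw [Pi.mul_apply, ← congrFun (restrict_extend (w - 1) u) y, mul_comm]
    rfl
  -- As τ = 1 on the section, the timelike term of the contraction supplies exactly the -D(u ⊗ v) of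
  -- the commutator sum.
  have hinr : (restrict fun p : Minkowski n => coordFun (.inr ()) p * extend (w - 1) u p) = u := by
    funext y
    rw [← congrFun (restrict_extend (w - 1) u) y]
    exact one_mul _
  have rU := represents_mk hU.smooth
  have rV := represents_mk hV.smooth
  have hsq : ∑ i : Fin (n + 1), coord i x * coord i x = 1 := by
    have h := EuclideanSpace.norm_sq_eq x.1
    rw [norm_eq_one, one_pow] at h
    rw [h]
    exact Finset.sum_congr rfl fun i _ => by rw [Real.norm_eq_abs, sq_abs, sq]; rfl
  have hlhs := Represents.sum (s := Finset.univ) fun i _ => ((represents_coordFun i).mul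
    (((represents_coordFun i).mul rU).ambientOperator rV (m + 1) w w)).const_smul (C.ε i)
  have hrhs := (represents_quad.mul (rU.ambientOperator rV (m + 1) w w)).add
    ((rU.ambientOperator rV m (w - 1) w).const_smul
      (-(((m : ℝ) + 1) * (n - 2 * (m + 1)) * (n + 2 * (m + 1) - 2) * (n + (m + 1) - 3) / 18)))
  have key := (C.sum_x_mul_ovsienkoRedou hw (rU.euler_eq hU) (rV.euler_eq hV) ▸ hrhs).eqOn hlhs hp
  simp only [norm_eq_one, sub_self, one_pow, zero_mul, zero_add] at key
  rw [Fintype.sum_sum_type, Finset.univ_unique (α := Unit), Finset.sum_singleton] at key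
  simp only [restrict] at hD
  simp only [hD, hinl] at key
  change _ = (∑ i : Fin (n + 1), (1 : ℝ) * (coord i x * _)) + (-1 : ℝ) * (1 * sphereOperator
    n (m + 1) w w (restrict fun p : Minkowski n => coordFun (.inr ()) p * extend (w - 1) u p) v x)
    at key
  rw [hinr] at key
  have hcomm : ∑ i : Fin (n + 1), coord i x *
      commutator (sphereOperator n (m + 1) w w) (coord i) u v x =
      ∑ i : Fin (n + 1), coord i x * sphereOperator n (m + 1) w w (u * coord i) v x
        - sphereOperator n (m + 1) w w u v x := by
    simp only [commutator, mul_sub, Finset.sum_sub_distrib, ← mul_assoc, ← Finset.sum_mul, hsq,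
      one_mul]
  simp only [one_mul, neg_one_mul, ← sub_eq_add_neg] at key
  rw [hcomm]
  exact key.symm

end OvsienkoRedou

end

theorem mainTheorem6 (n k : ℕ) (hk : 1 ≤ k) (hn : 2 * k < n) (w : ℝ)
    (hw : w = -((n : ℝ) - 2 * k) / 3) :
    -- both operators are well defined, independently of the choice of homogeneous extensions
    OvsienkoRedou.Induces (OvsienkoRedou.ambientOperator n k w w) w w
      (OvsienkoRedou.sphereOperator n k w w) ∧
    OvsienkoRedou.Induces
      (OvsienkoRedou.ambientOperator n (k - 1) (-((n : ℝ) - 2 * k + 3) / 3) w)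
      (-((n : ℝ) - 2 * k + 3) / 3) w
      (OvsienkoRedou.sphereOperator n (k - 1) (-((n : ℝ) - 2 * k + 3) / 3) w) ∧
    -- the commutator formula
    ∀ u v : OvsienkoRedou.Sph n → ℝ,
      ContMDiff (𝓡 n) 𝓘(ℝ, ℝ) ∞ u → ContMDiff (𝓡 n) 𝓘(ℝ, ℝ) ∞ v →
      ∀ x : OvsienkoRedou.Sph n,
        ∑ i : Fin (n + 1), OvsienkoRedou.coord i x *
            OvsienkoRedou.commutator (OvsienkoRedou.sphereOperator n k w w)
              (OvsienkoRedou.coord i) u v x =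
          -((k : ℝ) * ((n : ℝ) - 2 * k) * ((n : ℝ) + 2 * k - 2) * ((n : ℝ) + k - 3) / 18) *
            OvsienkoRedou.sphereOperator n (k - 1) (-((n : ℝ) - 2 * k + 3) / 3) w u v x := by
  refine ⟨OvsienkoRedou.induces_sphereOperator _ _ _ _,
    OvsienkoRedou.induces_sphereOperator _ _ _ _, fun u v hu hv x => ?_⟩
  obtain ⟨m, rfl⟩ := Nat.exists_eq_add_of_le' hk
  -- The first weight of the lower operator is the degree w - 1 chosen for the extension of u.
  rw [show -((n : ℝ) - 2 * (m + 1 : ℕ) + 3) / 3 = w - 1 by rw [hw]; ring]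
  push_cast at hw ⊢
  exact OvsienkoRedou.sum_coord_mul_commutator hw hu hv x
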